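/- Let $L\ge 1$ be an odd integer and consider $L$ fermionic modes with annihilation operators $a_0,\dots,a_{L-1}$ acting on the Fock space $(\mathbb C^2)^{\otimes L}$ with Fock basis $|n\rangle$, $n\in\{0,1\}^L$; all mode indices are understood modulo $L$. Let $CU_{\rm Sym}(L)$ be the compact group of unitary $L\times L$ matrices $u$ that are symmetric ($u_{i,j}=u_{j,i}$) and circulant ($u_{i+k,j+k}=u_{i,j}$). For such $u=e^{-ih}$ with $h$ Hermitian, let $U=\exp\big(i\sum_{p,q}h_{p,q}a_p^\dagger a_q\big)$ be the corresponding free-fermion evolution, which satisfies $Ua_pU^\dagger=\sum_q u_{p,q}a_q$ and depends only on $u$. Let $$\mathcal M(A)=\sum_{n\in\{0,1\}^L}\mathbb E_u\big[\langle n|UAU^\dagger|n\rangle\,U^\dagger|n\rangle\langle n|U\big]$$ be the measurement channel, where $u$ is Haar distributed on $CU_{\rm Sym}(L)$, and let $\mathcal M^+$ be its Moore–Penrose pseudo-inverse with respect to the Hilbert–Schmidt inner product $\mathrm{Tr}(A^\dagger B)$ on the operators on Fock space. Then for all $i\in\{0,\dots,L-2\}$ and $j\in\{0,\dots,L-1\}$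 with $j\ne i$, the operator $O_{ij}=a_i^\dagger a_j-a_{L-1}^\dagger a_{j-i-1}$ is nonzero and $$\mathcal M(O_{ij})=\tfrac1L\,O_{ij},\qquad \mathcal M^+(O_{ij})=L\,O_{ij}.$$ -/

import Mathlib

open Matrix MeasureTheory

noncomputable section
namespace FermionShadow
section ModeSpace
variable (L : ℕ) [NeZero L]

/-- The group `CU_Sym(L)` of symmetric circulant unitary `L × L` matrices. Modes are labelled by
`Fin L`, whose addition and subtraction are modulo `L`. -/
def symCirculantUnitary : Subgroup (Matrix.unitaryGroup (Fin L) ℂ) where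
  carrier := {u | (∀ i j k : Fin L, u.1 (i + k) (j + k) = u.1 i j) ∧
    ∀ i j : Fin L, u.1 i j = u.1 j i}
  mul_mem' := by
    rintro u v ⟨hu, hu'⟩ ⟨hv, hv'⟩
    refine ⟨fun i j k => ?_, fun i j => ?_⟩
    · change ∑ x, u.1 (i + k) x * v.1 x (j + k) = ∑ x, u.1 i x * v.1 x j
      rw [← Equiv.sum_comp (Equiv.addRight k)]
      simp [hu, hv]
    · change ∑ x, u.1 i x * v.1 x j = ∑ x, u.1 j x * v.1 x i
      rw [← Equiv.sum_comp (Equiv.subLeft (i + j))]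
      refine Finset.sum_congr rfl fun x _ => ?_
      have h1 := hu i (i + j - x) (x - i)
      have h2 := hv (i + j - x) j (x - j)
      rw [show i + (x - i) = x by abel, show i + j - x + (x - i) = j by abel] at h1
      rw [show j + (x - j) = x by abel, show i + j - x + (x - j) = i by abel] at h2
      simp only [Equiv.subLeft_apply]
      rw [← h1, ← h2, hu' x j, hv' i x]
  one_mem' := ⟨fun i j k => by simp [Matrix.one_apply], fun i j => by
    simp [Matrix.one_apply, eq_comm]⟩
  inv_mem' := by
    rintro u ⟨hu, hu'⟩
    exact ⟨fun i j k => congrArg star (hu j i k), fun i j => congrArg star (hu' j i)⟩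

instance : MeasurableSpace (symCirculantUnitary L) := borel _
instance : BorelSpace (symCirculantUnitary L) := ⟨rfl⟩

instance compactSpace_symCirculantUnitary : CompactSpace (symCirculantUnitary L) := by
  let K : Set (Matrix (Fin L) (Fin L) ℂ) :=
    Set.univ.pi fun _ => Set.univ.pi fun _ => Metric.closedBall (0 : ℂ) 1
  have hK : IsCompact K :=
    isCompact_univ_pi fun _ => isCompact_univ_pi fun _ => isCompact_closedBall _ _
  let f : symCirculantUnitary L → Matrix (Fin L) (Fin L) ℂ := fun u => u.1.1
  have hr : Set.range f = {M | star M * M = 1 ∧ M * star M = 1 ∧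
      (∀ i j k, M (i + k) (j + k) = M i j) ∧ ∀ i j, M i j = M j i} := by
    ext M
    constructor
    · rintro ⟨u, rfl⟩
      exact ⟨u.1.2.1, u.1.2.2, u.2.1, u.2.2⟩
    · rintro ⟨h1, h2, h3, h4⟩
      exact ⟨⟨⟨M, h1, h2⟩, h3, h4⟩, rfl⟩
  have hc : IsClosed (Set.range f) := by
    rw [hr]
    simp only [Set.ofPred_and, Set.ofPred_forall]
    refine (isClosed_eq (by fun_prop) (by fun_prop)).inter
      ((isClosed_eq (by fun_prop) (by fun_prop)).inter (IsClosed.inter ?_ ?_))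
    · exact isClosed_iInter fun i => isClosed_iInter fun j => isClosed_iInter fun k =>
        isClosed_eq (by fun_prop) (by fun_prop)
    · exact isClosed_iInter fun i => isClosed_iInter fun j =>
        isClosed_eq (by fun_prop) (by fun_prop)
  have hsub : Set.range f ⊆ K := by
    rintro _ ⟨u, rfl⟩ i - j -
    simpa using entry_norm_bound_of_unitary u.1.2 i j
  have hi : Topology.IsInducing f :=
    Topology.IsInducing.subtypeVal.comp Topology.IsInducing.subtypeVal
  refine ⟨hi.isCompact_iff.2 ?_⟩
  rw [Set.image_univ]
  exact hK.of_isClosed_subset hc hsub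

/-- The normalised Haar measure on the compact group `CU_Sym(L)`. -/
def haarCUSym : Measure (symCirculantUnitary L) :=
  Measure.haarMeasure ⊤

instance : IsProbabilityMeasure (haarCUSym L) := ⟨by
  rw [haarCUSym]
  exact Measure.haarMeasure_self (K₀ := (⊤ : TopologicalSpace.PositiveCompacts _))⟩
end ModeSpace

variable {L : ℕ}

/-- Occupation-number configurations `n ∈ {0,1}^L`; they label the Fock basis `|n⟩`. -/
abbrev Config (L : ℕ) : Type := Fin L → Bool
/-- Operators on the Fock space `(ℂ²)^{⊗ L}`, as matrices in the Fock basis. -/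
abbrev FockOp (L : ℕ) : Type := Matrix (Config L) (Config L) ℂ

/-- The sign `(-1)^{∑_{k<j} n_k}`. -/
def jwSign (n : Config L) (j : Fin L) : ℂ :=
  (-1) ^ (Finset.univ.filter fun k : Fin L => k < j ∧ n k = true).card

/-- The annihilation operator `a_j`: it sends `|n⟩` to `(-1)^{∑_{k<j} n_k} |n - e_j⟩` if `n_j = 1` and to
`0` if `n_j = 0`, which is its action on `|n⟩ = (a_0†)^{n_0} ⋯ (a_{L-1}†)^{n_{L-1}} |0⟩`. -/
def annihilation (j : Fin L) : FockOp L :=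
  Matrix.of fun m n =>
    if n j = true ∧ m = Function.update n j false then jwSign n j else 0

/-- The creation operator `a_j†`. -/
def creation (j : Fin L) : FockOp L := (annihilation j)ᴴ

theorem star_jwSign (n : Config L) (j : Fin L) : star (jwSign n j) = jwSign n j := by
  simp [jwSign]

theorem jwSign_mul_self (n : Config L) (j : Fin L) : jwSign n j * jwSign n j = 1 := by
  rw [jwSign, ← mul_pow]; simp

theorem jwSign_update_of_le (n : Config L) {i j : Fin L} (h : i ≤ j) (b : Bool) :
    jwSign (Function.update n j b) i = jwSign n i := by
  unfold jwSign
  congr 2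
  ext k
  simp only [Finset.mem_filter, Finset.mem_univ, true_and, and_congr_right_iff]
  intro hk
  rw [Function.update_of_ne (hk.trans_le h).ne]

theorem jwSign_update_of_lt (n : Config L) {i j : Fin L} (h : j < i) (b : Bool) (hb : n j ≠ b) :
    jwSign (Function.update n j b) i = -jwSign n i := by
  have key : ∀ m : Config L, m j = false →
      jwSign (Function.update m j true) i = -jwSign m i := by
    intro m hm
    unfold jwSign
    have : (Finset.univ.filter fun k : Fin L => k < i ∧ Function.update m j true k = true) =
        insert j (Finset.univ.filter fun k : Fin L => k < i ∧ m k = true) := by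
      ext k
      by_cases hk : k = j
      · subst hk; simp [h]
      · simp [hk]
    rw [this, Finset.card_insert_of_notMem (by simp [hm]), pow_succ]
    ring
  cases b with
  | true => exact key n (by simpa using hb)
  | false =>
    have h2 := key (Function.update n j false) (by simp)
    rw [Function.update_idem, show Function.update n j true = n from by
      rw [← show n j = true by simpa using hb, Function.update_eq_self]] at h2
    rw [h2, neg_neg]

theorem mul_annihilation_apply (A : FockOp L) (j : Fin L) (m n : Config L) :
    (A * annihilation j) m n =
      if n j = true then jwSign n j * A m (Function.update n j false) else 0 := by
  rw [Matrix.mul_apply]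
  by_cases h : n j = true
  · simp [annihilation, h, mul_comm]
  · simp [annihilation, h]

theorem creation_apply (j : Fin L) (m n : Config L) :
    creation j m n =
      if n j = false ∧ m = Function.update n j true then jwSign n j else 0 := by
  have : (m j = true ∧ n = Function.update m j false) ↔
      (n j = false ∧ m = Function.update n j true) := by
    constructor
    · rintro ⟨h1, rfl⟩
      simp [← h1]
    · rintro ⟨h1, rfl⟩
      simp [← h1]
  simp only [creation, annihilation, Matrix.conjTranspose_apply, Matrix.of_apply, this]
  split_ifs with h
  · rw [star_jwSign, h.2, jwSign_update_of_le _ le_rfl]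
  · simp

theorem mul_creation_apply (A : FockOp L) (j : Fin L) (m n : Config L) :
    (A * creation j) m n =
      if n j = false then jwSign n j * A m (Function.update n j true) else 0 := by
  rw [Matrix.mul_apply]
  by_cases h : n j = false
  · simp [creation_apply, h, mul_comm]
  · simp [creation_apply, h]

/-- `{a_i, a_j} = 0`. -/
theorem annihilation_anticomm (i j : Fin L) :
    annihilation i * annihilation j + annihilation j * annihilation i = 0 := by
  ext m n
  rw [Matrix.add_apply, mul_annihilation_apply, mul_annihilation_apply, Matrix.zero_apply]
  by_cases hij : i = j
  · subst hij
    simp [annihilation]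
  · wlog hlt : i < j generalizing i j
    · rw [add_comm]
      exact this j i (Ne.symm hij) (lt_of_le_of_ne (not_lt.1 hlt) (Ne.symm hij))
    by_cases hi : n i = true <;> by_cases hj : n j = true <;>
      simp [annihilation, hi, hj, hij, Ne.symm hij, jwSign_update_of_le n hlt.le,
        jwSign_update_of_lt n hlt false, Function.update_comm hij]
    split_ifs <;> ring

/-- `{a_i, a_j†} = δ_{ij}`. -/
theorem annihilation_creation_anticomm (i j : Fin L) :
    annihilation i * creation j + creation j * annihilation i = if i = j then 1 else 0 := by
  ext m n
  rw [Matrix.add_apply, mul_annihilation_apply, mul_creation_apply]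
  by_cases hij : i = j
  · subst hij
    by_cases hi : n i = true
    · have hu : Function.update n i true = n := by rw [← hi, Function.update_eq_self]
      simp [creation_apply, hi, hu, jwSign_update_of_le n le_rfl, jwSign_mul_self,
        Matrix.one_apply]
    · have hi' : n i = false := by simpa using hi
      have hu : Function.update n i false = n := by rw [← hi', Function.update_eq_self]
      simp [annihilation, hi', hu, jwSign_update_of_le n le_rfl, jwSign_mul_self,
        Matrix.one_apply]
  · rcases lt_or_gt_of_ne hij with hlt | hlt
    · by_cases hi : n i = true <;> by_cases hj : n j = true <;>
        simp [annihilation, creation_apply, hi, hj, hij, Ne.symm hij,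
          jwSign_update_of_le n hlt.le, jwSign_update_of_lt n hlt false,
          Function.update_comm hij]
      split_ifs <;> ring
    · by_cases hi : n i = true <;> by_cases hj : n j = true <;>
        simp [annihilation, creation_apply, hi, hj, hij, Ne.symm hij,
          jwSign_update_of_le n hlt.le, jwSign_update_of_lt n hlt true,
          Function.update_comm hij]
      split_ifs <;> ring

theorem creation_anticomm (i j : Fin L) :
    creation i * creation j + creation j * creation i = 0 := by
  have := congrArg Matrix.conjTranspose (annihilation_anticomm j i)
  simpa [creation] using this

/-- The free, particle number preserving operator `∑_{i,j} h_{ij} a_i† a_j`. -/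
def quadHamiltonian (h : Matrix (Fin L) (Fin L) ℂ) : FockOp L :=
  ∑ i, ∑ j, h i j • (creation i * annihilation j)

theorem quadHamiltonian_mul_creation (h : Matrix (Fin L) (Fin L) ℂ) (k : Fin L) :
    quadHamiltonian h * creation k =
      ∑ i, h i k • creation i + creation k * quadHamiltonian h := by
  have key : ∀ i j : Fin L, creation i * annihilation j * creation k =
      (if j = k then creation i else 0) + creation k * (creation i * annihilation j) := by
    intro i j
    have h1 := annihilation_creation_anticomm j k
    have h2 := creation_anticomm i k
    rw [Matrix.mul_assoc, eq_sub_of_add_eq h1, Matrix.mul_sub, ← Matrix.mul_assoc,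
      ← Matrix.mul_assoc, eq_neg_of_add_eq_zero_left h2]
    split_ifs <;> simp
  simp only [quadHamiltonian, Finset.sum_mul, Finset.mul_sum, Matrix.smul_mul, Matrix.mul_smul,
    key, smul_add, Finset.sum_add_distrib]
  simp [← Finset.sum_add_distrib]

open scoped Matrix.Norms.L2Operator in
/-- Every unitary matrix is `exp(-i h)` for a Hermitian matrix `h`. -/
theorem exists_hamiltonian {n : Type*} [Fintype n] [DecidableEq n] (u : Matrix.unitaryGroup n ℂ) :
    ∃ h : Matrix n n ℂ, h.IsHermitian ∧ NormedSpace.exp (-Complex.I • h) = u.1 := by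
  have hfin : (spectrum ℂ u.1).Finite := Matrix.finite_spectrum u.1
  have hcont : ∀ f : ℂ → ℂ, ContinuousOn f (spectrum ℂ u.1) := fun f => hfin.continuousOn f
  have hsa : IsSelfAdjoint (cfc (fun z => (Complex.arg z : ℂ)) u.1) := IsSelfAdjoint.cfc_arg u.1
  refine ⟨-cfc (fun z => (Complex.arg z : ℂ)) u.1, ?_, ?_⟩
  · exact hsa.neg
  · have : -Complex.I • -cfc (fun z => (Complex.arg z : ℂ)) u.1
        = cfc (fun z => Complex.I * (Complex.arg z : ℂ)) u.1 := by
      rw [cfc_const_mul _ _ _ (hcont _)]; simp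
    rw [this, ← CFC.exp_eq_normedSpace_exp (𝕜 := ℂ), ← cfc_comp' _ _ u.1 (hfin.image _ |>.continuousOn _) (hcont _)]
    conv_rhs => rw [← cfc_id ℂ u.1]
    refine cfc_congr fun z hz => ?_
    have hz1 : ‖z‖ = 1 := spectrum.norm_eq_one_of_unitary u.2 hz
    have := Complex.norm_mul_exp_arg_mul_I z
    rw [hz1] at this
    simpa [← Complex.exp_eq_exp_ℂ, mul_comm] using this

open scoped Matrix.Norms.L2Operator in
theorem exp_mul_of_intertwine {m n : Type*} [Fintype m] [DecidableEq m] [Fintype n]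
    [DecidableEq n] {A : Matrix m m ℂ} {B : Matrix n n ℂ} {X : Matrix m n ℂ}
    (h : A * X = X * B) : NormedSpace.exp A * X = X * NormedSpace.exp B := by
  have hpow : ∀ k : ℕ, A ^ k * X = X * B ^ k := by
    intro k
    induction k with
    | zero => simp
    | succ k ih => rw [pow_succ, Matrix.mul_assoc, h, ← Matrix.mul_assoc, ih, Matrix.mul_assoc,
        ← pow_succ]
  have hA := (NormedSpace.exp_series_hasSum_exp' (𝕂 := ℂ) A)
  have hB := (NormedSpace.exp_series_hasSum_exp' (𝕂 := ℂ) B)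
  have hA' : HasSum (fun k : ℕ => ((k.factorial : ℂ)⁻¹ • A ^ k) * X) (NormedSpace.exp A * X) :=
    hA.map (⟨⟨fun M => M * X, by simp⟩, fun M N => Matrix.add_mul M N X⟩ :
      Matrix m m ℂ →+ Matrix m n ℂ)
      (by change Continuous fun M : Matrix m m ℂ => M * X; fun_prop)
  have hB' : HasSum (fun k : ℕ => X * ((k.factorial : ℂ)⁻¹ • B ^ k)) (X * NormedSpace.exp B) :=
    hB.map (⟨⟨fun M => X * M, by simp⟩, fun M N => Matrix.mul_add X M N⟩ :
      Matrix n n ℂ →+ Matrix m n ℂ)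
      (by change Continuous fun M : Matrix n n ℂ => X * M; fun_prop)
  refine hA'.unique ?_
  convert hB' using 2 with k
  rw [Matrix.smul_mul, Matrix.mul_smul, hpow]

open scoped Kronecker in
open scoped Matrix.Norms.L2Operator in
theorem exp_kronecker_sum {m n : Type*} [Fintype m] [DecidableEq m] [Fintype n]
    [DecidableEq n] (A : Matrix m m ℂ) (B : Matrix n n ℂ) :
    NormedSpace.exp (A ⊗ₖ (1 : Matrix n n ℂ) + (1 : Matrix m m ℂ) ⊗ₖ B) =
      NormedSpace.exp A ⊗ₖ NormedSpace.exp B := by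
  have hc : Commute (A ⊗ₖ (1 : Matrix n n ℂ)) ((1 : Matrix m m ℂ) ⊗ₖ B) := by
    simp [Commute, SemiconjBy, ← Matrix.mul_kronecker_mul]
  have h1 : NormedSpace.exp (A ⊗ₖ (1 : Matrix n n ℂ)) = NormedSpace.exp A ⊗ₖ 1 := by
    let f : Matrix m m ℂ →+* Matrix (m × n) (m × n) ℂ :=
      { toFun := fun M => M ⊗ₖ (1 : Matrix n n ℂ)
        map_one' := by simp
        map_mul' := fun M N => by simp [← Matrix.mul_kronecker_mul]
        map_zero' := by simp
        map_add' := fun M N => Matrix.add_kronecker M N 1 }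
    let _ := NormedAlgebra.restrictScalars ℚ ℂ (Matrix m m ℂ)
    exact (NormedSpace.map_exp f (by
      change Continuous fun M : Matrix m m ℂ => M ⊗ₖ (1 : Matrix n n ℂ)
      refine continuous_matrix fun i j => ?_
      simp only [Matrix.kroneckerMap_apply]; fun_prop) A).symm
  have h2 : NormedSpace.exp ((1 : Matrix m m ℂ) ⊗ₖ B) = 1 ⊗ₖ NormedSpace.exp B := by
    let f : Matrix n n ℂ →+* Matrix (m × n) (m × n) ℂ :=
      { toFun := fun M => (1 : Matrix m m ℂ) ⊗ₖ M
        map_one' := by simp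
        map_mul' := fun M N => by simp [← Matrix.mul_kronecker_mul]
        map_zero' := by simp
        map_add' := fun M N => Matrix.kronecker_add 1 M N }
    let _ := NormedAlgebra.restrictScalars ℚ ℂ (Matrix n n ℂ)
    exact (NormedSpace.map_exp f (by
      change Continuous fun M : Matrix n n ℂ => (1 : Matrix m m ℂ) ⊗ₖ M
      refine continuous_matrix fun i j => ?_
      simp only [Matrix.kroneckerMap_apply]; fun_prop) B).symm
  rw [Matrix.exp_add_of_commute _ _ hc, h1, h2, ← Matrix.mul_kronecker_mul]
  simp

theorem exp_quadHamiltonian_mul_creation (z : ℂ) (h : Matrix (Fin L) (Fin L) ℂ) (k : Fin L) :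
    NormedSpace.exp (z • quadHamiltonian h) * creation k =
      (∑ i, NormedSpace.exp (z • h) i k • creation i) *
        NormedSpace.exp (z • quadHamiltonian h) := by
  let X : Matrix (Config L) (Fin L × Config L) ℂ := Matrix.of fun s p => creation p.1 s p.2
  have hmul : ∀ (A : FockOp L) s p, (A * X) s p = (A * creation p.1) s p.2 := fun A s p => rfl
  have hX : (z • quadHamiltonian h) * X =
      X * (Matrix.kronecker (z • h) 1 + Matrix.kronecker 1 (z • quadHamiltonian h)) := by
    ext s ⟨k, t⟩
    rw [hmul]
    simp only [Matrix.smul_mul, quadHamiltonian_mul_creation]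
    simp [X, Matrix.mul_apply, Fintype.sum_prod_type, Matrix.one_apply, Finset.sum_add_distrib,
      mul_add, Matrix.sum_apply, Finset.mul_sum, mul_left_comm, mul_comm]
  have := exp_mul_of_intertwine hX
  have h2 := exp_kronecker_sum (z • h) (z • quadHamiltonian h)
  erw [h2] at this
  ext s t
  have h3 := congrFun (congrFun this s) (k, t)
  rw [hmul] at h3
  rw [h3]
  simp [X, Matrix.mul_apply, Fintype.sum_prod_type, Matrix.sum_apply, Finset.sum_mul]
  rw [Finset.sum_comm]
  exact Finset.sum_congr rfl fun _ _ => Finset.sum_congr rfl fun _ _ => by ring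

theorem exp_quadHamiltonian_mul_vacuum (z : ℂ) (h : Matrix (Fin L) (Fin L) ℂ) (n : Config L) :
    NormedSpace.exp (z • quadHamiltonian h) * Matrix.single (fun _ => false) n (1 : ℂ) =
      Matrix.single (fun _ => false) n (1 : ℂ) := by
  have h0 : ∀ j : Fin L,
      annihilation j * Matrix.single (fun _ => false) n (1 : ℂ) = (0 : FockOp L) := by
    intro j
    ext s t
    rw [Matrix.mul_apply, Matrix.zero_apply]
    refine Finset.sum_eq_zero fun r _ => ?_
    by_cases hr : (fun _ => false) = r
    · subst hr; simp [annihilation]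
    · simp [hr]
  have h1 : (z • quadHamiltonian h) * Matrix.single (fun _ => false) n (1 : ℂ) =
      Matrix.single (fun _ => false) n (1 : ℂ) * (0 : FockOp L) := by
    simp [quadHamiltonian, Finset.sum_mul, Matrix.mul_assoc, h0]
  simpa using exp_mul_of_intertwine h1

/-- The free evolution `U = exp(i ∑ h_{ij} a_i† a_j)` on Fock space whose mode-space unitary is
`u = exp(-i h)`, with `h` Hermitian. It depends on `u` only, not on the choice of `h`: it fixes the
vacuum (`exp_quadHamiltonian_mul_vacuum`), and `U a_k† U† = ∑_i conj(u_{ki}) a_i†`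
(`freeEvolution_mul_creation`), that is `U a_k U† = ∑_i u_{ki} a_i`. -/
def freeEvolution (u : Matrix.unitaryGroup (Fin L) ℂ) : FockOp L :=
  NormedSpace.exp (Complex.I • quadHamiltonian (Classical.choose (exists_hamiltonian u)))

/-- `U a_k† = (∑_i conj(u_{ki}) a_i†) U`. -/
theorem freeEvolution_mul_creation (u : Matrix.unitaryGroup (Fin L) ℂ) (k : Fin L) :
    freeEvolution u * creation k =
      (∑ i, star (u.1 k i) • creation i) * freeEvolution u := by
  obtain ⟨hh, hu⟩ := Classical.choose_spec (exists_hamiltonian u)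
  rw [freeEvolution, exp_quadHamiltonian_mul_creation]
  set h := Classical.choose (exists_hamiltonian u)
  have : NormedSpace.exp (Complex.I • h) = (u.1)ᴴ := by
    rw [← hu, ← Matrix.exp_conjTranspose, Matrix.conjTranspose_smul, hh.eq]
    simp
  rw [this]
  rfl

theorem creation_mul_single (j : Fin L) (n m : Config L) (hn : n j = true) :
    creation j * Matrix.single (Function.update n j false) m (1 : ℂ) =
      jwSign n j • Matrix.single n m (1 : ℂ) := by
  have hu : Function.update n j true = n := by rw [← hn, Function.update_eq_self]
  ext s t
  rw [Matrix.mul_apply, Finset.sum_eq_single (Function.update n j false)]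
  · by_cases hs : s = n
    · subst hs
      simp [creation_apply, hu, Matrix.single_apply, jwSign_update_of_le s le_rfl]
    · simp [creation_apply, hu, hs, Ne.symm hs]
  · intro r _ hr
    simp [Ne.symm hr]
  · simp

/-- The Fock-space unitary depends continuously on the mode-space unitary. -/
theorem continuous_freeEvolution :
    Continuous (freeEvolution : Matrix.unitaryGroup (Fin L) ℂ → FockOp L) := by
  have key : ∀ (d : ℕ) (n m : Config L), (Finset.univ.filter fun k => n k = true).card = d →
      Continuous fun u : Matrix.unitaryGroup (Fin L) ℂ =>
        freeEvolution u * Matrix.single n m (1 : ℂ) := by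
    intro d
    induction d with
    | zero =>
      intro n m hd
      have hn : n = fun _ => false := by
        ext k
        simpa using Finset.filter_eq_empty_iff.1 (Finset.card_eq_zero.1 hd) (Finset.mem_univ k)
      subst hn
      simp only [freeEvolution, exp_quadHamiltonian_mul_vacuum]
      exact continuous_const
    | succ d ih =>
      intro n m hd
      obtain ⟨j, hj⟩ := Finset.card_pos.1 (by rw [hd]; exact Nat.succ_pos d)
      have hnj : n j = true := by simpa using hj
      have hd' : (Finset.univ.filter
          fun k => Function.update n j false k = true).card = d := by
        have : (Finset.univ.filter fun k => Function.update n j false k = true) =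
            (Finset.univ.filter fun k => n k = true).erase j := by
          ext k
          by_cases hk : k = j
          · subst hk; simp
          · simp [hk]
        rw [this, Finset.card_erase_of_mem hj, hd, Nat.add_sub_cancel]
      have hs : Matrix.single n m (1 : ℂ) =
          jwSign n j • (creation j * Matrix.single (Function.update n j false) m (1 : ℂ)) := by
        rw [creation_mul_single j n m hnj, smul_smul, jwSign_mul_self, one_smul]
      simp only [hs, Matrix.mul_smul, ← Matrix.mul_assoc, freeEvolution_mul_creation]
      simp only [Matrix.mul_assoc]
      have h1 := ih _ m hd'
      have h2 : Continuous fun u : Matrix.unitaryGroup (Fin L) ℂ =>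
          ∑ i, star (u.1 j i) • creation i := by
        refine continuous_finsetSum _ fun i _ => ?_
        have h3 : Continuous fun u : Matrix.unitaryGroup (Fin L) ℂ => star (u.1 j i) :=
          (continuous_subtype_val.matrix_elem j i).star
        fun_prop
      exact (continuous_const_smul (jwSign n j)).comp (h2.matrix_mul h1)
  refine continuous_matrix fun m n => ?_
  have := (key _ n n rfl).matrix_elem m n
  simpa using this


section Channel
variable (L) [NeZero L]

/-- The mode with index `L - 1`. -/
def lastMode : Fin L := ⟨L - 1, Nat.sub_lt (NeZero.pos L) one_pos⟩

/-- `⟨n| U A U† |n⟩ • U† |n⟩⟨n| U`, where `U` is the free evolution with mode-space unitary `u`. -/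
def channelIntegrand (u : symCirculantUnitary L) (n : Config L) (A : FockOp L) : FockOp L :=
  (freeEvolution u.1 * A * (freeEvolution u.1)ᴴ) n n •
    ((freeEvolution u.1)ᴴ * Matrix.single n n 1 * freeEvolution u.1)

theorem integrable_channelIntegrand (n : Config L) (A : FockOp L) (s t : Config L) :
    Integrable (fun u => channelIntegrand L u n A s t) (haarCUSym L) := by
  have hU : Continuous fun u : symCirculantUnitary L => freeEvolution u.1 :=
    continuous_freeEvolution.comp continuous_subtype_val
  have h1 : Continuous fun u : symCirculantUnitary L =>
      (freeEvolution u.1 * A * (freeEvolution u.1)ᴴ) n n :=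
    ((hU.matrix_mul continuous_const).matrix_mul hU.matrix_conjTranspose).matrix_elem n n
  have h2 : Continuous fun u : symCirculantUnitary L =>
      ((freeEvolution u.1)ᴴ * Matrix.single n n 1 * freeEvolution u.1 : FockOp L) s t :=
    ((hU.matrix_conjTranspose.matrix_mul continuous_const).matrix_mul hU).matrix_elem s t
  exact (h1.mul h2).integrable_of_hasCompactSupport (HasCompactSupport.of_compactSpace _)

/-- The measurement channel `M(A) = ∑_{n ∈ {0,1}^L} E_u [⟨n| U A U† |n⟩ U† |n⟩⟨n| U]`, where the mode-space
unitary `u` of `U` is Haar distributed on `CU_Sym(L)`; the expectation of an operator is taken entrywise. -/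
def measurementChannel : FockOp L →ₗ[ℂ] FockOp L where
  toFun A := ∑ n : Config L,
    Matrix.of fun s t => ∫ u, channelIntegrand L u n A s t ∂(haarCUSym L)
  map_add' A B := by
    rw [← Finset.sum_add_distrib]
    refine Finset.sum_congr rfl fun n _ => ?_
    ext s t
    simp only [Matrix.of_apply, Matrix.add_apply]
    rw [← integral_add (integrable_channelIntegrand L n A s t)
      (integrable_channelIntegrand L n B s t)]
    congr 1
    ext u
    simp [channelIntegrand, Matrix.mul_add, add_mul]
  map_smul' c A := by
    rw [RingHom.id_apply, Finset.smul_sum]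
    refine Finset.sum_congr rfl fun n _ => ?_
    ext s t
    simp only [Matrix.of_apply, Matrix.smul_apply, smul_eq_mul]
    rw [← integral_const_mul]
    congr 1
    ext u
    simp [channelIntegrand, mul_assoc]

end Channel

section PseudoInverse
variable {ι : Type*} [Fintype ι]

/-- The Hilbert-Schmidt inner product `Tr(A† B)`. -/
def hsInner (A B : Matrix ι ι ℂ) : ℂ := (Aᴴ * B).trace

/-- `P` is the Moore-Penrose inverse of the superoperator `T` with respect to the Hilbert-Schmidt inner
product: the four Penrose conditions. -/
structure IsMoorePenroseInverse (T P : Matrix ι ι ℂ →ₗ[ℂ] Matrix ι ι ℂ) : Prop where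
  mul_inv_mul : T ∘ₗ P ∘ₗ T = T
  inv_mul_inv : P ∘ₗ T ∘ₗ P = P
  selfAdjoint_mul_inv : ∀ A B, hsInner (T (P A)) B = hsInner A (T (P B))
  selfAdjoint_inv_mul : ∀ A B, hsInner (P (T A)) B = hsInner A (P (T B))

theorem exists_moorePenrose_aux {V : Type*} [NormedAddCommGroup V] [InnerProductSpace ℂ V]
    [FiniteDimensional ℂ V] (T : V →ₗ[ℂ] V) :
    ∃ P : V →ₗ[ℂ] V, T ∘ₗ P ∘ₗ T = T ∧ P ∘ₗ T ∘ₗ P = P ∧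
      (∀ x y, inner ℂ (T (P x)) y = inner ℂ x (T (P y))) ∧
      ∀ x y, inner ℂ (P (T x)) y = inner ℂ x (P (T y)) := by
  let R := LinearMap.range T
  let K := LinearMap.ker T
  let e : Kᗮ ≃ₗ[ℂ] R := T.kerComplementEquivRange K.isCompl_orthogonal.symm
  let P : V →ₗ[ℂ] V := Kᗮ.subtype ∘ₗ e.symm.toLinearMap ∘ₗ R.orthogonalProjectionOnto.toLinearMap
  have he : ∀ x : Kᗮ, (e x : V) = T x := fun x => rfl
  have hTP : ∀ x, T (P x) = R.starProjection x := by
    intro x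
    change T (e.symm (R.orthogonalProjectionOnto x) : V) = _
    rw [← he, LinearEquiv.apply_symm_apply]
    rfl
  have hPT : ∀ x, P (T x) = Kᗮ.starProjection x := by
    intro x
    have h1 : T x = T (Kᗮ.starProjection x) := by
      have h2 : x - Kᗮ.starProjection x ∈ Kᗮᗮ := Submodule.sub_starProjection_mem_orthogonal x
      rw [Submodule.orthogonal_orthogonal] at h2
      have h3 : T (x - Kᗮ.starProjection x) = 0 := h2
      rwa [map_sub, sub_eq_zero] at h3
    rw [h1]
    change (e.symm (R.orthogonalProjectionOnto (T (Kᗮ.orthogonalProjectionOnto x : V))) : V) = _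
    rw [← he, Submodule.orthogonalProjectionOnto_mem_subspace_eq_self,
      LinearEquiv.symm_apply_apply]
    rfl
  refine ⟨P, ?_, ?_, ?_, ?_⟩
  · ext x
    change T (P (T x)) = T x
    rw [hTP]
    exact Submodule.starProjection_eq_self_iff.2 (LinearMap.mem_range_self T x)
  · ext x
    change P (T (P x)) = P x
    rw [hPT]
    exact Submodule.starProjection_eq_self_iff.2 (e.symm _).2
  · intro x y
    rw [hTP, hTP]
    exact Submodule.inner_starProjection_left_eq_right R x y
  · intro x y
    rw [hPT, hPT]
    exact Submodule.inner_starProjection_left_eq_right Kᗮ x y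

open scoped ComplexOrder in
theorem exists_isMoorePenroseInverse [DecidableEq ι] (T : Matrix ι ι ℂ →ₗ[ℂ] Matrix ι ι ℂ) :
    ∃ P, IsMoorePenroseInverse T P := by
  let _ : NormedAddCommGroup (Matrix ι ι ℂ) := Matrix.toMatrixNormedAddCommGroup 1 Matrix.PosDef.one
  let _ : InnerProductSpace ℂ (Matrix ι ι ℂ) :=
    Matrix.toMatrixInnerProductSpace 1 Matrix.PosSemidef.one
  have hin : ∀ A B : Matrix ι ι ℂ, inner ℂ A B = hsInner A B := by
    intro A B
    change (B * 1 * Aᴴ).trace = (Aᴴ * B).trace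
    rw [Matrix.mul_one, Matrix.trace_mul_comm]
  obtain ⟨P, h1, h2, h3, h4⟩ := exists_moorePenrose_aux T
  exact ⟨P, h1, h2, fun A B => by simpa only [hin] using h3 A B,
    fun A B => by simpa only [hin] using h4 A B⟩

open scoped ComplexOrder in
theorem IsMoorePenroseInverse.unique {T P Q : Matrix ι ι ℂ →ₗ[ℂ] Matrix ι ι ℂ}
    (hP : IsMoorePenroseInverse T P) (hQ : IsMoorePenroseInverse T Q) : P = Q := by
  have hext : ∀ X Y : Matrix ι ι ℂ, (∀ B, hsInner X B = hsInner Y B) → X = Y := by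
    intro X Y h
    have h1 := h (X - Y)
    have h2 : ((X - Y)ᴴ * (X - Y)).trace = 0 := by
      rw [Matrix.conjTranspose_sub, Matrix.sub_mul, Matrix.trace_sub]
      exact sub_eq_zero.2 h1
    exact sub_eq_zero.1 (Matrix.trace_conjTranspose_mul_self_eq_zero_iff.1 h2)
  have p1 : ∀ A, T (P (T A)) = T A := fun A => LinearMap.congr_fun hP.mul_inv_mul A
  have p2 : ∀ A, P (T (P A)) = P A := fun A => LinearMap.congr_fun hP.inv_mul_inv A
  have q1 : ∀ A, T (Q (T A)) = T A := fun A => LinearMap.congr_fun hQ.mul_inv_mul A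
  have q2 : ∀ A, Q (T (Q A)) = Q A := fun A => LinearMap.congr_fun hQ.inv_mul_inv A
  have hPT : ∀ A, P (T A) = Q (T A) := fun A => hext _ _ fun B => by
    rw [← q1 A, hP.selfAdjoint_inv_mul, hQ.selfAdjoint_inv_mul, p1, ← hQ.selfAdjoint_inv_mul, q1]
  have hTP : ∀ A, T (P A) = T (Q A) := fun A => hext _ _ fun B => by
    rw [hP.selfAdjoint_mul_inv, ← q1 (P B), ← hQ.selfAdjoint_mul_inv, ← hP.selfAdjoint_mul_inv, p1]
  ext1 A
  rw [← p2 A, hPT, hTP, q2]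

/-- The Moore-Penrose pseudo-inverse of a superoperator with respect to the Hilbert-Schmidt inner product
(it is unique by `IsMoorePenroseInverse.unique`). -/
def pseudoInverse [DecidableEq ι] (T : Matrix ι ι ℂ →ₗ[ℂ] Matrix ι ι ℂ) : Matrix ι ι ℂ →ₗ[ℂ] Matrix ι ι ℂ :=
  Classical.choose (exists_isMoorePenroseInverse T)

end PseudoInverse

end FermionShadow
end

namespace FermionShadow
-- Heisenberg evolution of creation and annihilation operators and of quadratic monomials.
section FockSpace
variable {L : ℕ}

/-! Free evolution acts linearly on modes, so the channel preserves the span of the quadratic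
monomials: `M(a_p† a_q) = ∑_{k,l} C a_k† a_l`, where `C` is the Haar average of `∑_r conj(u_{pr})
u_{qr} u_{kr} conj(u_{lr})` (`measurementChannel_creation_mul_annihilation`).

Plane waves diagonalise circulant matrices. Unitarity makes the eigenvalues `λ_ψ` unimodular,
symmetry makes them even (`λ_{ψ⁻¹} = λ_ψ`), and otherwise they are arbitrary
(`exists_circulantEigenvalue_eq`). After Fourier expansion the sum over `r` imposes `a d = b c` on
the four characters, and there remains the average of `conj(λ_a) λ_b λ_c conj(λ_d)`. The integrand
is a character of the group, so the average is 1 or 0 according to whether that character is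
trivial. Evenness could allow pairings up to inversion, but together with `a d = b c` they force `(a
d)² = 1`. For odd `L` this means `a d = 1`, and the pairing is then an ordinary one, `{b, c} = {a,
d}` (`exists_unpaired`, `integral_circulantEigenvalue`).

Counting the two pairings and removing their overlap gives `channelCoeff_eq`. For `p ≠ q`, `M(a_p†
a_q)` is `L⁻¹ a_p† a_q` minus a term depending only on `q - p`. Two monomials with the same nonzero
shift therefore have a difference that is an eigenvector for `1/L`. Since `L - 1 = -1` modulo `L`,
the two monomials of `O_{ij}` both have shift `j - i`. Finally, the channel is Hilbert–Schmidt
self-adjoint, so its pseudo-inverse inverts nonzero eigenvalues on eigenvectors. -/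

theorem conjTranspose_creation (k : Fin L) : (creation k)ᴴ = annihilation k :=
  Matrix.conjTranspose_conjTranspose _

theorem conjTranspose_annihilation (k : Fin L) : (annihilation k)ᴴ = creation k := rfl

theorem isHermitian_quadHamiltonian {h : Matrix (Fin L) (Fin L) ℂ} (hh : h.IsHermitian) :
    (quadHamiltonian h).IsHermitian := by
  rw [Matrix.IsHermitian, quadHamiltonian]
  simp only [Matrix.conjTranspose_sum, Matrix.conjTranspose_smul, Matrix.conjTranspose_mul,
    conjTranspose_creation, conjTranspose_annihilation]
  rw [Finset.sum_comm]
  refine Finset.sum_congr rfl fun i _ => Finset.sum_congr rfl fun j _ => ?_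
  rw [hh.apply]

theorem conjTranspose_freeEvolution_mul_self (u : Matrix.unitaryGroup (Fin L) ℂ) :
    (freeEvolution u)ᴴ * freeEvolution u = 1 := by
  have hh := isHermitian_quadHamiltonian (Classical.choose_spec (exists_hamiltonian u)).1
  rw [freeEvolution, ← Matrix.exp_conjTranspose, Matrix.conjTranspose_smul, hh.eq,
    show star Complex.I = -Complex.I by simp, neg_smul, Matrix.exp_neg]
  exact Matrix.nonsing_inv_mul _ ((Matrix.isUnit_iff_isUnit_det _).1 (Matrix.isUnit_exp _))

theorem freeEvolution_mul_conjTranspose_self (u : Matrix.unitaryGroup (Fin L) ℂ) :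
    freeEvolution u * (freeEvolution u)ᴴ = 1 :=
  mul_eq_one_comm.1 (conjTranspose_freeEvolution_mul_self u)

theorem freeEvolution_conj_creation (u : Matrix.unitaryGroup (Fin L) ℂ) (k : Fin L) :
    freeEvolution u * creation k * (freeEvolution u)ᴴ = ∑ i, star (u.1 k i) • creation i := by
  rw [freeEvolution_mul_creation, Matrix.mul_assoc, freeEvolution_mul_conjTranspose_self,
    Matrix.mul_one]

theorem freeEvolution_conj_annihilation (u : Matrix.unitaryGroup (Fin L) ℂ) (k : Fin L) :
    freeEvolution u * annihilation k * (freeEvolution u)ᴴ = ∑ i, u.1 k i • annihilation i := by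
  have := congrArg Matrix.conjTranspose (freeEvolution_conj_creation u k)
  simpa [Matrix.conjTranspose_sum, Matrix.conjTranspose_smul, Matrix.conjTranspose_mul,
    conjTranspose_creation, Matrix.mul_assoc] using this

/-- Inverting `freeEvolution_mul_creation` amounts to solving for a combination of creation
operators that `U` carries to `a_r†`; orthonormality of the columns of `u` supplies it. -/
theorem freeEvolution_inv_conj_creation (u : Matrix.unitaryGroup (Fin L) ℂ) (r : Fin L) :
    (freeEvolution u)ᴴ * creation r * freeEvolution u = ∑ k, u.1 k r • creation k := by
  have h1 : freeEvolution u * (∑ k, u.1 k r • creation k) = creation r * freeEvolution u := by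
    have h2 : ∀ i, ∑ k, u.1 k r * star (u.1 k i) = if i = r then 1 else 0 := by
      intro i
      have := congrFun (congrFun (Matrix.mem_unitaryGroup_iff'.1 u.2) i) r
      rw [Matrix.mul_apply, Matrix.one_apply] at this
      rw [← this]
      exact Finset.sum_congr rfl fun k _ => mul_comm _ _
    simp only [Finset.mul_sum, Matrix.mul_smul, freeEvolution_mul_creation]
    simp only [← Matrix.smul_mul, ← Finset.sum_mul, Finset.smul_sum, smul_smul]
    rw [Finset.sum_comm]
    simp only [← Finset.sum_smul, h2]
    simp
  rw [Matrix.mul_assoc, ← h1, ← Matrix.mul_assoc, conjTranspose_freeEvolution_mul_self,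
    Matrix.one_mul]

theorem freeEvolution_inv_conj_annihilation (u : Matrix.unitaryGroup (Fin L) ℂ) (r : Fin L) :
    (freeEvolution u)ᴴ * annihilation r * freeEvolution u =
      ∑ k, star (u.1 k r) • annihilation k := by
  have := congrArg Matrix.conjTranspose (freeEvolution_inv_conj_creation u r)
  simpa [Matrix.conjTranspose_sum, Matrix.conjTranspose_smul, Matrix.conjTranspose_mul,
    conjTranspose_creation, Matrix.mul_assoc] using this

theorem creation_mul_annihilation_apply (r s : Fin L) (m n : Config L) :
    (creation r * annihilation s) m n =
      if n s = true ∧ Function.update n s false r = false ∧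
          m = Function.update (Function.update n s false) r true then
        jwSign n s * jwSign (Function.update n s false) r else 0 := by
  rw [mul_annihilation_apply, creation_apply]
  split_ifs <;> simp_all

theorem creation_mul_annihilation_self (r : Fin L) :
    creation r * annihilation r =
      (Matrix.diagonal fun n : Config L => if n r = true then (1 : ℂ) else 0) := by
  ext m n
  rw [creation_mul_annihilation_apply, Matrix.diagonal_apply]
  by_cases hn : n r = true
  · have hu : Function.update n r true = n := by rw [← hn, Function.update_eq_self]
    by_cases hm : m = n
    · subst hm
      simp [hn, hu, jwSign_update_of_le m le_rfl, jwSign_mul_self]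
    · simp [hu, hm]
  · by_cases hm : m = n
    · subst hm
      simp [hn]
    · simp [hn, hm]

theorem creation_mul_annihilation_diag (r s : Fin L) (n : Config L) :
    (creation r * annihilation s) n n = if r = s then (if n r = true then 1 else 0) else 0 := by
  by_cases hrs : r = s
  · subst hrs
    rw [creation_mul_annihilation_self]
    simp
  · rw [creation_mul_annihilation_apply, if_neg, if_neg hrs]
    rintro ⟨h1, -, h3⟩
    have := congrFun h3 s
    rw [Function.update_of_ne (Ne.symm hrs), Function.update_self, h1] at this
    exact absurd this (by simp)

/-- Among the monomials `a_r† a_s` produced by the evolution, only the number operators `r = s` have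
diagonal entries in the Fock basis. -/
theorem freeEvolution_conj_diag (u : Matrix.unitaryGroup (Fin L) ℂ) (p q : Fin L) (n : Config L) :
    (freeEvolution u * (creation p * annihilation q) * (freeEvolution u)ᴴ) n n =
      ∑ r, star (u.1 p r) * u.1 q r * if n r = true then 1 else 0 := by
  have h : freeEvolution u * (creation p * annihilation q) * (freeEvolution u)ᴴ =
      (freeEvolution u * creation p * (freeEvolution u)ᴴ) *
        (freeEvolution u * annihilation q * (freeEvolution u)ᴴ) := by
    calc _ = freeEvolution u * creation p * 1 * annihilation q * (freeEvolution u)ᴴ := by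
          simp only [Matrix.mul_assoc, Matrix.one_mul]
      _ = _ := by
          rw [← conjTranspose_freeEvolution_mul_self u]
          simp only [Matrix.mul_assoc]
  rw [h, freeEvolution_conj_creation, freeEvolution_conj_annihilation]
  simp only [Finset.sum_mul, Finset.mul_sum, Matrix.smul_mul, Matrix.mul_smul, Matrix.sum_apply,
    Matrix.smul_apply, creation_mul_annihilation_diag, smul_eq_mul]
  refine Finset.sum_congr rfl fun r _ => ?_
  simp [mul_comm]

theorem freeEvolution_inv_conj_number (u : Matrix.unitaryGroup (Fin L) ℂ) (r : Fin L) :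
    (freeEvolution u)ᴴ * (creation r * annihilation r) * freeEvolution u =
      ∑ k, ∑ l, (u.1 k r * star (u.1 l r)) • (creation k * annihilation l) := by
  have h : (freeEvolution u)ᴴ * (creation r * annihilation r) * freeEvolution u =
      ((freeEvolution u)ᴴ * creation r * freeEvolution u) *
        ((freeEvolution u)ᴴ * annihilation r * freeEvolution u) := by
    calc _ = (freeEvolution u)ᴴ * creation r * 1 * annihilation r * freeEvolution u := by
          simp only [Matrix.mul_assoc, Matrix.one_mul]
      _ = _ := by
          rw [← freeEvolution_mul_conjTranspose_self u]
          simp only [Matrix.mul_assoc]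
  rw [h, freeEvolution_inv_conj_creation, freeEvolution_inv_conj_annihilation]
  simp only [Finset.sum_mul, Finset.mul_sum, Matrix.smul_mul, Matrix.mul_smul, smul_smul]
  rw [Finset.sum_comm]
  simp only [mul_comm]

/-- The matrix entry from the one-particle state at `j` to the one at `i` separates the terms: the
first gives 1, while the second can only reach states in which `k` is occupied. -/
theorem creation_mul_annihilation_ne_zero_sub {i j k l : Fin L} (hij : i ≠ j) (hik : i ≠ k) :
    creation i * annihilation j - creation k * annihilation l ≠ 0 := by
  intro h
  have h1 := congrFun (congrFun h (Function.update (fun _ => false) i true))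
    (Function.update (fun _ => false) j true)
  rw [Matrix.sub_apply, creation_mul_annihilation_apply, creation_mul_annihilation_apply,
    if_pos (by simp [hij]), if_neg] at h1
  · simp [jwSign] at h1
  · rintro ⟨-, -, h4⟩
    have := congrFun h4 k
    rw [Function.update_self, Function.update_of_ne (Ne.symm hik)] at this
    exact absurd this (by simp)

end FockSpace

/-! ### The channel on quadratic monomials, and its self-adjointness. -/

section ChannelFormula
variable (L : ℕ) [NeZero L]

theorem sum_channelIntegrand (u : symCirculantUnitary L) (p q : Fin L) :
    ∑ n, channelIntegrand L u n (creation p * annihilation q) =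
      ∑ k, ∑ l, (∑ r, star (u.1.1 p r) * u.1.1 q r * u.1.1 k r * star (u.1.1 l r)) •
        (creation k * annihilation l) := by
  -- Summing over outcomes rebuilds the number operator from its spectral decomposition `∑_n n_r
  -- |n⟩⟨n|`; hence the output is again quadratic.
  have h1 : ∀ r : Fin L, (∑ n : Config L, (if n r = true then (1 : ℂ) else 0) •
      ((freeEvolution u.1)ᴴ * Matrix.single n n 1 * freeEvolution u.1)) =
      (freeEvolution u.1)ᴴ * (creation r * annihilation r) * freeEvolution u.1 := by
    intro r
    rw [creation_mul_annihilation_self, ← Matrix.sum_single_eq_diagonal, Finset.mul_sum,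
      Finset.sum_mul]
    refine Finset.sum_congr rfl fun n _ => ?_
    rw [← Matrix.smul_mul, ← Matrix.mul_smul, Matrix.smul_single, smul_eq_mul, mul_one]
  simp only [channelIntegrand, freeEvolution_conj_diag, Finset.sum_smul, mul_smul]
  rw [Finset.sum_comm]
  simp only [← mul_smul]
  simp only [mul_smul, ← Finset.smul_sum, h1, freeEvolution_inv_conj_number]
  simp only [Finset.smul_sum, smul_smul]
  rw [Finset.sum_comm]
  refine Finset.sum_congr rfl fun k _ => ?_
  rw [Finset.sum_comm]

/-- The coefficient of `a_k† a_l` in `M(a_p† a_q)`. -/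
noncomputable def channelCoeff (p q k l : Fin L) : ℂ :=
  ∫ u, ∑ r, star (u.1.1 p r) * u.1.1 q r * u.1.1 k r * star (u.1.1 l r) ∂(haarCUSym L)

theorem integrable_of_continuous {f : symCirculantUnitary L → ℂ} (hf : Continuous f) :
    Integrable f (haarCUSym L) :=
  hf.integrable_of_hasCompactSupport (HasCompactSupport.of_compactSpace _)

theorem continuous_entry (p q : Fin L) :
    Continuous fun u : symCirculantUnitary L => u.1.1 p q :=
  (continuous_subtype_val.comp continuous_subtype_val).matrix_elem p q

theorem measurementChannel_apply (A : FockOp L) (s t : Config L) :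
    measurementChannel L A s t =
      ∑ n : Config L, ∫ u, channelIntegrand L u n A s t ∂(haarCUSym L) := by
  change (∑ n : Config L, Matrix.of fun s t => ∫ u, channelIntegrand L u n A s t
    ∂(haarCUSym L)) s t = _
  rw [Matrix.sum_apply]
  rfl

theorem measurementChannel_creation_mul_annihilation (p q : Fin L) :
    measurementChannel L (creation p * annihilation q) =
      ∑ k, ∑ l, channelCoeff L p q k l • (creation k * annihilation l) := by
  ext s t
  have h2 : ∀ k l : Fin L, Integrable (fun u : symCirculantUnitary L =>
      (∑ r, star (u.1.1 p r) * u.1.1 q r * u.1.1 k r * star (u.1.1 l r)) *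
        (creation k * annihilation l) s t) (haarCUSym L) := by
    intro k l
    refine integrable_of_continuous L ?_
    exact (continuous_finsetSum _ fun r _ => ((((continuous_entry L p r).star.mul
      (continuous_entry L q r)).mul (continuous_entry L k r)).mul
      (continuous_entry L l r).star)).mul continuous_const
  have h3 : ∀ u : symCirculantUnitary L,
      ∑ n, channelIntegrand L u n (creation p * annihilation q) s t =
        ∑ k, ∑ l, (∑ r, star (u.1.1 p r) * u.1.1 q r * u.1.1 k r * star (u.1.1 l r)) *
          (creation k * annihilation l) s t := by
    intro u
    rw [← Matrix.sum_apply, sum_channelIntegrand]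
    simp only [Matrix.sum_apply, Matrix.smul_apply, smul_eq_mul]
  rw [measurementChannel_apply,
    ← integral_finsetSum _ fun n _ => integrable_channelIntegrand L n _ s t,
    integral_congr_ae (Filter.Eventually.of_forall h3),
    integral_finsetSum _ fun k _ => integrable_finsetSum _ fun l _ => h2 k l, Matrix.sum_apply]
  refine Finset.sum_congr rfl fun k _ => ?_
  rw [integral_finsetSum _ fun l _ => h2 k l, Matrix.sum_apply]
  refine Finset.sum_congr rfl fun l _ => ?_
  rw [integral_mul_const, Matrix.smul_apply, smul_eq_mul, channelCoeff]

/-- Both sides are the average over `u` of `∑_n conj(⟨n|UAU†|n⟩) ⟨n|UBU†|n⟩`, a Hermitian form in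
`A` and `B`. -/
theorem hsInner_measurementChannel (A B : FockOp L) :
    hsInner (measurementChannel L A) B = hsInner A (measurementChannel L B) := by
  have h1 : ∀ (A B : FockOp L), hsInner A (measurementChannel L B) =
      ∫ u, ∑ n : Config L, hsInner A (channelIntegrand L u n B) ∂(haarCUSym L) := by
    intro A B
    have hint : ∀ (n s t : Config L), Integrable
        (fun u => Aᴴ s t * channelIntegrand L u n B t s) (haarCUSym L) := fun n s t =>
      (integrable_channelIntegrand L n B t s).const_mul _
    simp only [hsInner, Matrix.trace, Matrix.diag, Matrix.mul_apply]
    rw [integral_finsetSum _ fun n _ => integrable_finsetSum _ fun s _ =>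
      integrable_finsetSum _ fun t _ => hint n s t]
    have h2 : ∀ n, ∫ u, ∑ s, ∑ t, Aᴴ s t * channelIntegrand L u n B t s ∂(haarCUSym L) =
        ∑ s, ∑ t, Aᴴ s t * ∫ u, channelIntegrand L u n B t s ∂(haarCUSym L) := by
      intro n
      rw [integral_finsetSum _ fun s _ => integrable_finsetSum _ fun t _ => hint n s t]
      refine Finset.sum_congr rfl fun s _ => ?_
      rw [integral_finsetSum _ fun t _ => hint n s t]
      simp only [integral_const_mul]
    simp only [h2, measurementChannel_apply, Finset.mul_sum]
    rw [eq_comm, Finset.sum_comm]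
    refine Finset.sum_congr rfl fun s _ => ?_
    rw [Finset.sum_comm]
  have hstar : ∀ A B : FockOp L, hsInner A B = star (hsInner B A) := by
    intro A B
    rw [hsInner, hsInner, ← Matrix.trace_conjTranspose, Matrix.conjTranspose_mul,
      Matrix.conjTranspose_conjTranspose]
  have h3 : ∀ (u : symCirculantUnitary L) (n : Config L) (A B : FockOp L),
      hsInner A (channelIntegrand L u n B) =
        (freeEvolution u.1 * B * (freeEvolution u.1)ᴴ) n n *
          star ((freeEvolution u.1 * A * (freeEvolution u.1)ᴴ) n n) := by
    intro u n A B
    rw [hsInner, channelIntegrand, Matrix.mul_smul, Matrix.trace_smul, smul_eq_mul]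
    congr 1
    rw [← Matrix.mul_assoc, Matrix.trace_mul_comm, ← Matrix.mul_assoc, ← Matrix.mul_assoc,
      Matrix.trace_mul_single, ← Matrix.conjTranspose_apply, Matrix.conjTranspose_mul,
      Matrix.conjTranspose_mul, Matrix.conjTranspose_conjTranspose]
    simp [Matrix.mul_assoc]
  rw [hstar, h1, h1, ← starRingEnd_apply, ← integral_conj]
  congr 1
  ext u
  rw [map_sum]
  refine Finset.sum_congr rfl fun n _ => ?_
  rw [h3, h3, map_mul, starRingEnd_apply, starRingEnd_apply, star_star, mul_comm]

end ChannelFormula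

/-! ### The pseudo-inverse of a self-adjoint superoperator on an eigenvector. -/

section PseudoInverse
variable {ι : Type*} [Fintype ι] [DecidableEq ι]

open scoped ComplexOrder in
-- Put `Y = X - P(TX)`, which lies in `ker T`. Self-adjointness of `T` makes `Y` orthogonal to its
-- eigenvector `X`, and self-adjointness of `P T` makes `Y` orthogonal to `P(TX)`. Thus `Y` is
-- orthogonal to itself, and `X = P(TX) = c P X`.
theorem pseudoInverse_apply_of_apply_eq_smul {T : Matrix ι ι ℂ →ₗ[ℂ] Matrix ι ι ℂ}
    (hT : ∀ A B, hsInner (T A) B = hsInner A (T B)) {c : ℂ} (hc : c ≠ 0) {X : Matrix ι ι ℂ}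
    (hX : T X = c • X) : pseudoInverse T X = c⁻¹ • X := by
  have hP : IsMoorePenroseInverse T (pseudoInverse T) :=
    Classical.choose_spec (exists_isMoorePenroseInverse T)
  set P := pseudoInverse T
  have hTPT : ∀ A, T (P (T A)) = T A := fun A => LinearMap.congr_fun hP.mul_inv_mul A
  have hsub : ∀ A B C : Matrix ι ι ℂ, hsInner A (B - C) = hsInner A B - hsInner A C := by
    intro A B C
    simp [hsInner, Matrix.mul_sub]
  have hsm : ∀ (A B : Matrix ι ι ℂ) (z : ℂ), hsInner A (z • B) = z * hsInner A B := by
    intro A B z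
    simp [hsInner]
  have hzero : ∀ B : Matrix ι ι ℂ, hsInner 0 B = 0 := by
    intro B
    simp [hsInner]
  have hY : T (X - P (T X)) = 0 := by rw [map_sub, hTPT, sub_self]
  have hYX : hsInner (X - P (T X)) X = 0 := by
    have := hT (X - P (T X)) X
    rw [hY, hX, hsm, hzero] at this
    simpa only [hX] using (mul_eq_zero.1 this.symm).resolve_left hc
  have hYP : hsInner (X - P (T X)) (P (T X)) = 0 := by
    rw [← hP.selfAdjoint_inv_mul, hY, map_zero, hzero]
  have h0 : hsInner (X - P (T X)) (X - P (T X)) = 0 := by rw [hsub, hYX, hYP, sub_zero]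
  have hfix := sub_eq_zero.1 (Matrix.trace_conjTranspose_mul_self_eq_zero_iff.1 h0)
  rw [hX, map_smul] at hfix
  rw [eq_inv_smul_iff₀ hc]
  exact hfix.symm

end PseudoInverse
-- Fourier analysis on the mode group and Haar averages of eigenvalues.
section Fourier
variable {L : ℕ} [NeZero L]

local notation "ModeChar" => AddChar (Fin L) ℂ

theorem star_addChar_apply (ψ : ModeChar) (x : Fin L) : star (ψ x) = ψ (-x) :=
  (AddChar.map_neg_eq_conj ψ x).symm

theorem sum_addChar_apply (x : Fin L) :
    ∑ ψ : ModeChar, ψ x = if x = 0 then (L : ℂ) else 0 := by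
  rw [AddChar.sum_apply_eq_ite]
  simp

theorem sum_addChar_mul_apply_neg (φ ψ : ModeChar) :
    ∑ x, φ x * ψ (-x) = if φ = ψ then (L : ℂ) else 0 := by
  have h : ∀ x, φ x * ψ (-x) = (φ * ψ⁻¹) x := fun x => by
    rw [AddChar.mul_apply, AddChar.inv_apply]
  simp only [h]
  rw [AddChar.sum_eq_ite]
  -- The trivial character is written `0` by `AddChar.sum_eq_ite`; it agrees definitionally with the
  -- multiplicative `1`.
  have h2 : φ * ψ⁻¹ = 0 ↔ φ = ψ := mul_inv_eq_one
  simp [h2]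

theorem cast_ne_zero_of_neZero : (L : ℂ) ≠ 0 := Nat.cast_ne_zero.2 (NeZero.ne L)

/-- The eigenvalue of the circulant matrix `u` on the plane wave `ψ`. -/
noncomputable def circulantEigenvalue (u : symCirculantUnitary L) (ψ : ModeChar) : ℂ :=
  ∑ x, u.1.1 x 0 * ψ (-x)

theorem symCirculantUnitary_apply (u : symCirculantUnitary L) (p r : Fin L) :
    u.1.1 p r = u.1.1 (p - r) 0 := by
  simpa using u.2.1 (p - r) 0 r

theorem symCirculantUnitary_apply_neg (u : symCirculantUnitary L) (x : Fin L) :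
    u.1.1 (-x) 0 = u.1.1 x 0 := by
  rw [u.2.2 x 0, symCirculantUnitary_apply u 0 x, zero_sub]

/-- Fourier inversion of the first column of `u`. -/
theorem symCirculantUnitary_apply_eq_sum (u : symCirculantUnitary L) (p r : Fin L) :
    u.1.1 p r = (L : ℂ)⁻¹ * ∑ ψ : ModeChar, circulantEigenvalue u ψ * ψ (p - r) := by
  have h : ∑ ψ : ModeChar, circulantEigenvalue u ψ * ψ (p - r) =
      ∑ x, u.1.1 x 0 * ∑ ψ : ModeChar, ψ (-x + (p - r)) := by
    simp only [circulantEigenvalue, Finset.sum_mul, Finset.mul_sum, AddChar.map_add_eq_mul,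
      mul_assoc]
    exact Finset.sum_comm
  have h2 : ∀ x, (-x + (p - r) = 0) ↔ x = p - r := fun x => by
    rw [neg_add_eq_zero]
  rw [h]
  simp only [sum_addChar_apply, h2]
  rw [symCirculantUnitary_apply]
  simp only [mul_ite, mul_zero, Finset.sum_ite_eq', Finset.mem_univ, if_true]
  rw [mul_comm _ (L : ℂ), inv_mul_cancel_left₀ cast_ne_zero_of_neZero]

/-- The convolution theorem. It makes every product of eigenvalues and their conjugates a character
of the symmetric circulant group. -/
theorem circulantEigenvalue_mul (u v : symCirculantUnitary L) (ψ : ModeChar) :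
    circulantEigenvalue (u * v) ψ = circulantEigenvalue u ψ * circulantEigenvalue v ψ := by
  have h : ∀ x, (u * v).1.1 x 0 = ∑ y, u.1.1 (x - y) 0 * v.1.1 y 0 := by
    intro x
    change ∑ y, u.1.1 x y * v.1.1 y 0 = _
    exact Finset.sum_congr rfl fun y _ => by rw [symCirculantUnitary_apply]
  simp only [circulantEigenvalue, h]
  rw [Finset.sum_mul_sum]
  simp only [Finset.sum_mul]
  rw [Finset.sum_comm]
  rw [Finset.sum_comm (f := fun i j => _ * ψ (-i) * _)]
  refine Finset.sum_congr rfl fun y _ => ?_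
  rw [← Equiv.sum_comp (Equiv.addRight y)]
  refine Finset.sum_congr rfl fun x _ => ?_
  simp only [Equiv.coe_addRight, add_sub_cancel_right, neg_add, AddChar.map_add_eq_mul]
  ring

theorem circulantEigenvalue_inv_char (u : symCirculantUnitary L) (ψ : ModeChar) :
    circulantEigenvalue u ψ⁻¹ = circulantEigenvalue u ψ := by
  rw [circulantEigenvalue, ← Equiv.sum_comp (Equiv.neg (Fin L))]
  simp [circulantEigenvalue, symCirculantUnitary_apply_neg]

theorem circulantEigenvalue_one (ψ : ModeChar) :
    circulantEigenvalue (1 : symCirculantUnitary L) ψ = 1 := by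
  simp [circulantEigenvalue, Matrix.one_apply]

theorem circulantEigenvalue_inv (u : symCirculantUnitary L) (ψ : ModeChar) :
    circulantEigenvalue u⁻¹ ψ = star (circulantEigenvalue u ψ) := by
  rw [← circulantEigenvalue_inv_char u, circulantEigenvalue, circulantEigenvalue, star_sum]
  refine Finset.sum_congr rfl fun x _ => ?_
  rw [star_mul', star_addChar_apply, AddChar.inv_apply, neg_neg, u.2.2 x 0]
  rfl

theorem star_circulantEigenvalue_mul_self (u : symCirculantUnitary L) (ψ : ModeChar) :
    star (circulantEigenvalue u ψ) * circulantEigenvalue u ψ = 1 := by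
  rw [← circulantEigenvalue_inv, ← circulantEigenvalue_mul, inv_mul_cancel,
    circulantEigenvalue_one]

theorem continuous_circulantEigenvalue (ψ : ModeChar) :
    Continuous fun u : symCirculantUnitary L => circulantEigenvalue u ψ :=
  continuous_finsetSum _ fun x _ => (continuous_entry L x 0).mul continuous_const

/-- Every even unimodular function on the dual group is the spectrum of a symmetric circulant
unitary matrix. -/
theorem exists_circulantEigenvalue_eq (θ : ModeChar → ℂ) (h1 : ∀ ψ, θ ψ * star (θ ψ) = 1)
    (h2 : ∀ ψ, θ ψ⁻¹ = θ ψ) :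
    ∃ v : symCirculantUnitary L, ∀ ψ, circulantEigenvalue v ψ = θ ψ := by
  let M : Matrix (Fin L) (Fin L) ℂ :=
    Matrix.of fun p r => (L : ℂ)⁻¹ * ∑ ψ : ModeChar, θ ψ * ψ (p - r)
  have hL : (L : ℂ) ≠ 0 := cast_ne_zero_of_neZero
  have hM : M * star M = 1 := by
    ext p q
    have h3 : ∀ r, M p r * star (M q r) = (L : ℂ)⁻¹ * (L : ℂ)⁻¹ *
        ∑ φ : ModeChar, ∑ ψ : ModeChar, θ ψ * star (θ φ) * ψ p * φ (-q) * (φ r * ψ (-r)) := by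
      intro r
      simp only [M, Matrix.of_apply, star_mul', star_sum, star_addChar_apply, star_inv₀,
        star_natCast]
      rw [mul_mul_mul_comm, Finset.sum_mul_sum, Finset.sum_comm]
      congr 1
      refine Finset.sum_congr rfl fun φ _ => Finset.sum_congr rfl fun ψ _ => ?_
      rw [neg_sub, sub_eq_add_neg, sub_eq_add_neg, AddChar.map_add_eq_mul,
        AddChar.map_add_eq_mul]
      ring
    rw [Matrix.mul_apply]
    simp only [Matrix.star_apply, h3]
    rw [← Finset.mul_sum, Finset.sum_comm]
    have h4 : ∀ φ : ModeChar, ∑ r, ∑ ψ : ModeChar, θ ψ * star (θ φ) * ψ p * φ (-q) * (φ r * ψ (-r)) =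
        L * φ (p - q) := by
      intro φ
      rw [Finset.sum_comm]
      simp only [← Finset.mul_sum, sum_addChar_mul_apply_neg]
      simp only [mul_ite, mul_zero, Finset.sum_ite_eq, Finset.mem_univ, if_true, h1]
      rw [sub_eq_add_neg, AddChar.map_add_eq_mul]
      ring
    simp only [h4]
    rw [← Finset.mul_sum, sum_addChar_apply, Matrix.one_apply]
    simp only [sub_eq_zero]
    split_ifs
    · field_simp
    · simp
  refine ⟨⟨⟨M, Matrix.mem_unitaryGroup_iff.2 hM⟩, fun i j k => ?_, fun i j => ?_⟩, fun ψ => ?_⟩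
  · simp [M]
  · simp only [M, Matrix.of_apply]
    rw [← Equiv.sum_comp (Equiv.inv ModeChar)]
    simp [h2]
  · simp only [circulantEigenvalue, M, Matrix.of_apply, sub_zero]
    simp only [mul_assoc, Finset.sum_mul, ← Finset.mul_sum]
    rw [Finset.sum_comm]
    simp only [← Finset.mul_sum, sum_addChar_mul_apply_neg]
    simp only [mul_ite, mul_zero, Finset.sum_ite_eq', Finset.mem_univ, if_true]
    field_simp

/-- Each value of `ψ` is both a square root of unity and an `L`-th root of unity. This is the one
place where the oddness of `L` does its work. -/
theorem eq_one_of_mul_self_eq_one (hL : Odd L) {ψ : ModeChar} (h : ψ * ψ = 1) : ψ = 1 := by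
  ext x
  have h1 : ψ x ^ 2 = 1 := by
    rw [sq, ← AddChar.mul_apply, h, AddChar.one_apply]
  have h2 : ψ x ^ L = 1 := by
    rw [← AddChar.map_nsmul_eq_pow]
    have : L • x = 0 := by simpa using card_nsmul_eq_zero (x := x)
    rw [this, AddChar.map_zero_eq_one]
  obtain ⟨m, hm⟩ := hL
  have h3 : ψ x ^ (2 * m + 1) = 1 := (congrArg (ψ x ^ ·) hm).symm.trans h2
  rw [pow_succ, pow_mul, h1, one_pow, one_mul] at h3
  rw [h3, AddChar.one_apply]

/-- If no such `g` existed, each of `b, c` would match one of `a, d` up to inversion, and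
conversely. As the ordinary pairings are excluded, all matches are with inverses, whence `b c = (a
d)⁻¹`. With `a d = b c` and no 2-torsion this gives `a d = 1`, and then the match for `b` becomes an
ordinary one. -/
theorem exists_unpaired {G : Type*} [CommGroup G] (hG : ∀ g : G, g * g = 1 → g = 1)
    {a b c d : G} (h : a * d = b * c) (hn : ¬ ((b = a ∧ c = d) ∨ (b = d ∧ c = a))) :
    (∃ g, (g = b ∨ g = c) ∧ g ≠ a ∧ g ≠ a⁻¹ ∧ g ≠ d ∧ g ≠ d⁻¹) ∨
      ∃ g, (g = a ∨ g = d) ∧ g ≠ b ∧ g ≠ b⁻¹ ∧ g ≠ c ∧ g ≠ c⁻¹ := by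
  by_contra hcon
  obtain ⟨hl, hr⟩ := not_or.1 hcon
  have hba : b ≠ a := by
    rintro rfl
    exact hn (Or.inl ⟨rfl, (mul_left_cancel h).symm⟩)
  have hbd : b ≠ d := by
    rintro rfl
    exact hn (Or.inr ⟨rfl, (mul_left_cancel ((mul_comm _ _).trans h)).symm⟩)
  have hca : c ≠ a := by
    rintro rfl
    exact hbd (mul_right_cancel (h.symm.trans (mul_comm _ _)))
  have hcd : c ≠ d := by
    rintro rfl
    exact hba (mul_right_cancel h).symm
  have hb : b = a⁻¹ ∨ b = d⁻¹ := by
    by_contra hx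
    exact hl ⟨b, Or.inl rfl, hba, fun e => hx (Or.inl e), hbd, fun e => hx (Or.inr e)⟩
  have hc : c = a⁻¹ ∨ c = d⁻¹ := by
    by_contra hx
    exact hl ⟨c, Or.inr rfl, hca, fun e => hx (Or.inl e), hcd, fun e => hx (Or.inr e)⟩
  have ha : a = b⁻¹ ∨ a = c⁻¹ := by
    by_contra hx
    exact hr ⟨a, Or.inl rfl, hba.symm, fun e => hx (Or.inl e), hca.symm, fun e => hx (Or.inr e)⟩
  have hd : d = b⁻¹ ∨ d = c⁻¹ := by
    by_contra hx
    exact hr ⟨d, Or.inr rfl, hbd.symm, fun e => hx (Or.inl e), hcd.symm, fun e => hx (Or.inr e)⟩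
  have hmul : b * c = (a * d)⁻¹ → False := by
    intro e
    have h1 : a * d = 1 := hG _ (by nth_rewrite 1 [h]; rw [e, inv_mul_cancel])
    rcases hb with hb | hb
    · exact hbd (hb.trans (inv_eq_of_mul_eq_one_right h1))
    · exact hba (hb.trans (inv_eq_of_mul_eq_one_left h1))
  rcases hb with hb | hb <;> rcases hc with hc | hc
  · have e : d = a := by rcases hd with hd | hd <;> simp [hd, hb, hc]
    exact hmul (by rw [hb, hc, e, mul_inv])
  · exact hmul (by rw [hb, hc, mul_inv])
  · exact hmul (by rw [hb, hc, mul_inv, mul_comm])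
  · have e : a = d := by rcases ha with ha | ha <;> simp [ha, hb, hc]
    exact hmul (by rw [hb, hc, e, mul_inv])

theorem integral_circulantEigenvalue (hL : Odd L) {a b c d : ModeChar} (h : a * d = b * c) :
    ∫ u, star (circulantEigenvalue u a) * circulantEigenvalue u b * circulantEigenvalue u c *
      star (circulantEigenvalue u d) ∂(haarCUSym L) =
      if (b = a ∧ c = d) ∨ (b = d ∧ c = a) then 1 else 0 := by
  split_ifs with hn
  · have : ∀ u : symCirculantUnitary L, star (circulantEigenvalue u a) * circulantEigenvalue u b *
        circulantEigenvalue u c * star (circulantEigenvalue u d) = 1 := by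
      intro u
      have h1 := star_circulantEigenvalue_mul_self u a
      have h2 := star_circulantEigenvalue_mul_self u d
      rcases hn with ⟨rfl, rfl⟩ | ⟨rfl, rfl⟩
      · rw [h1, one_mul, mul_comm, h2]
      · rw [mul_right_comm _ _ (circulantEigenvalue u c), h1, one_mul, mul_comm, h2]
    simp only [this]
    simp
  · classical
    -- A nontrivial character has zero Haar average: translating by `v` multiplies the integral by a
    -- factor different from 1.
    suffices hv : ∃ v : symCirculantUnitary L,
        star (circulantEigenvalue v a) * circulantEigenvalue v b * circulantEigenvalue v c *
          star (circulantEigenvalue v d) ≠ 1 by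
      obtain ⟨v, hv⟩ := hv
      set F : symCirculantUnitary L → ℂ := fun u =>
        star (circulantEigenvalue u a) * circulantEigenvalue u b * circulantEigenvalue u c *
          star (circulantEigenvalue u d) with hF
      have hmul : ∀ u, F (v * u) = F v * F u := by
        intro u
        simp only [hF, circulantEigenvalue_mul, star_mul']
        ring
      have : (haarCUSym L).IsMulLeftInvariant := by
        rw [haarCUSym]; infer_instance
      have hI : ∫ u, F u ∂(haarCUSym L) = F v * ∫ u, F u ∂(haarCUSym L) := by
        rw [← integral_const_mul, ← integral_mul_left_eq_self F v]
        simp only [hmul]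
      by_contra h0
      exact hv (mul_right_cancel₀ h0 (by rw [one_mul]; exact hI.symm))
    -- The test element is changed at both `g` and `g⁻¹` to stay even. The value `I` is used rather
    -- than `-1` because `g` may account for two of the four factors, and `I² ≠ 1`.
    have key : ∀ g : ModeChar, ∃ v : symCirculantUnitary L, ∀ ψ,
        circulantEigenvalue v ψ = if g = ψ ∨ g = ψ⁻¹ then Complex.I else 1 := by
      intro g
      refine exists_circulantEigenvalue_eq _ (fun ψ => ?_) (fun ψ => ?_)
      · split_ifs <;> simp
      · simp [or_comm]
    rcases exists_unpaired (fun g => eq_one_of_mul_self_eq_one hL) h hn with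
      ⟨g, hg, h1, h2, h3, h4⟩ | ⟨g, hg, h1, h2, h3, h4⟩
    · obtain ⟨v, hv⟩ := key g
      refine ⟨v, ?_⟩
      rw [hv a, hv d, if_neg (by tauto), if_neg (by tauto)]
      rcases hg with hg | hg
      · rw [hv b, if_pos (Or.inl hg), hv c]
        split_ifs <;> norm_num [Complex.ext_iff]
      · rw [hv c, if_pos (Or.inl hg), hv b]
        split_ifs <;> norm_num [Complex.ext_iff]
    · obtain ⟨v, hv⟩ := key g
      refine ⟨v, ?_⟩
      rw [hv b, hv c, if_neg (by tauto), if_neg (by tauto)]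
      rcases hg with hg | hg
      · rw [hv a, if_pos (Or.inl hg), hv d]
        split_ifs <;> norm_num [Complex.ext_iff]
      · rw [hv d, if_pos (Or.inl hg), hv a]
        split_ifs <;> norm_num [Complex.ext_iff]

/-- Momentum conservation: orthogonality of characters in the common column index `r`. -/
theorem sum_addChar_mul_sum (a b c d : ModeChar) :
    ∑ r, a r * b (-r) * c (-r) * d r = if a * d = b * c then (L : ℂ) else 0 := by
  rw [← sum_addChar_mul_apply_neg]
  refine Finset.sum_congr rfl fun r _ => ?_
  rw [AddChar.mul_apply, AddChar.mul_apply]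
  ring

theorem sum_symCirculantUnitary_apply (u : symCirculantUnitary L) (p q k l : Fin L) :
    ∑ r, star (u.1.1 p r) * u.1.1 q r * u.1.1 k r * star (u.1.1 l r) =
      ((L : ℂ)⁻¹) ^ 3 * ∑ a : ModeChar, ∑ d : ModeChar, ∑ b : ModeChar, ∑ c : ModeChar,
        if a * d = b * c then
          star (circulantEigenvalue u a) * circulantEigenvalue u b * circulantEigenvalue u c *
            star (circulantEigenvalue u d) * (a (-p) * b q * c k * d (-l)) else 0 := by
  have hL : (L : ℂ) ≠ 0 := cast_ne_zero_of_neZero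
  have h1 : ∀ p r, star (u.1.1 p r) =
      (L : ℂ)⁻¹ * ∑ a : ModeChar, star (circulantEigenvalue u a) * (a (-p) * a r) := by
    intro p r
    rw [symCirculantUnitary_apply_eq_sum, star_mul', star_inv₀, star_natCast, star_sum]
    congr 1
    refine Finset.sum_congr rfl fun a _ => ?_
    rw [star_mul', star_addChar_apply, ← AddChar.map_add_eq_mul, neg_sub, sub_eq_neg_add]
  have h2 : ∀ p r, u.1.1 p r =
      (L : ℂ)⁻¹ * ∑ a : ModeChar, circulantEigenvalue u a * (a p * a (-r)) := by
    intro p r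
    rw [symCirculantUnitary_apply_eq_sum]
    simp only [← AddChar.map_add_eq_mul, sub_eq_add_neg]
  have h3 : ∀ r, star (u.1.1 p r) * u.1.1 q r * u.1.1 k r * star (u.1.1 l r) =
      ((L : ℂ)⁻¹) ^ 4 * ∑ a : ModeChar, ∑ d : ModeChar, ∑ b : ModeChar, ∑ c : ModeChar,
          star (circulantEigenvalue u a) * circulantEigenvalue u b * circulantEigenvalue u c *
            star (circulantEigenvalue u d) * (a (-p) * b q * c k * d (-l)) *
            (a r * b (-r) * c (-r) * d r) := by
    intro r
    rw [h1 p, h1 l, h2 q, h2 k]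
    have e : ∀ A B C D : ℂ, (L : ℂ)⁻¹ * A * ((L : ℂ)⁻¹ * B) * ((L : ℂ)⁻¹ * C) *
        ((L : ℂ)⁻¹ * D) = ((L : ℂ)⁻¹) ^ 4 * ((A * D) * (B * C)) := fun A B C D => by ring
    rw [e]
    congr 1
    simp only [Finset.sum_mul_sum]
    refine Finset.sum_congr rfl fun a _ => ?_
    rw [Finset.sum_comm]
    refine Finset.sum_congr rfl fun d _ => Finset.sum_congr rfl fun b _ =>
      Finset.sum_congr rfl fun c _ => ?_
    ring
  simp only [h3]
  -- One of the four factors `L⁻¹` is split off, to cancel the `L` produced by the sum over `r`.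
  rw [← Finset.mul_sum, pow_succ, mul_assoc]
  congr 1
  rw [Finset.sum_comm, Finset.mul_sum]
  refine Finset.sum_congr rfl fun a _ => ?_
  rw [Finset.sum_comm, Finset.mul_sum]
  refine Finset.sum_congr rfl fun d _ => ?_
  rw [Finset.sum_comm, Finset.mul_sum]
  refine Finset.sum_congr rfl fun b _ => ?_
  rw [Finset.sum_comm, Finset.mul_sum]
  refine Finset.sum_congr rfl fun c _ => ?_
  rw [← Finset.mul_sum, sum_addChar_mul_sum]
  split_ifs
  · field_simp
  · simp

theorem channelCoeff_eq_sum (hL : Odd L) (p q k l : Fin L) :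
    channelCoeff L p q k l = ((L : ℂ)⁻¹) ^ 3 *
      ∑ a : ModeChar, ∑ d : ModeChar, ∑ b : ModeChar, ∑ c : ModeChar,
        if (b = a ∧ c = d) ∨ (b = d ∧ c = a) then a (-p) * b q * c k * d (-l) else 0 := by
  rw [channelCoeff]
  simp only [sum_symCirculantUnitary_apply]
  rw [integral_const_mul]
  congr 1
  have hint : ∀ a d b c : ModeChar, Integrable (fun u : symCirculantUnitary L =>
      if a * d = b * c then
        star (circulantEigenvalue u a) * circulantEigenvalue u b * circulantEigenvalue u c *
          star (circulantEigenvalue u d) * (a (-p) * b q * c k * d (-l)) else 0)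
      (haarCUSym L) := by
    intro a d b c
    refine integrable_of_continuous L ?_
    split_ifs
    · exact ((((continuous_circulantEigenvalue a).star.mul (continuous_circulantEigenvalue b)).mul
        (continuous_circulantEigenvalue c)).mul (continuous_circulantEigenvalue d).star).mul
          continuous_const
    · exact continuous_const
  rw [integral_finsetSum _ fun a _ => integrable_finsetSum _ fun d _ =>
    integrable_finsetSum _ fun b _ => integrable_finsetSum _ fun c _ => hint a d b c]
  refine Finset.sum_congr rfl fun a _ => ?_
  rw [integral_finsetSum _ fun d _ =>
    integrable_finsetSum _ fun b _ => integrable_finsetSum _ fun c _ => hint a d b c]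
  refine Finset.sum_congr rfl fun d _ => ?_
  rw [integral_finsetSum _ fun b _ => integrable_finsetSum _ fun c _ => hint a d b c]
  refine Finset.sum_congr rfl fun b _ => ?_
  rw [integral_finsetSum _ fun c _ => hint a d b c]
  refine Finset.sum_congr rfl fun c _ => ?_
  by_cases h : a * d = b * c
  · simp only [if_pos h]
    rw [integral_mul_const, integral_circulantEigenvalue hL h]
    split_ifs <;> simp
  · simp only [if_neg h]
    rw [if_neg, integral_zero]
    rintro (⟨rfl, rfl⟩ | ⟨rfl, rfl⟩)
    · exact h rfl
    · exact h (mul_comm _ _)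

theorem channelCoeff_eq (hL : Odd L) (p q k l : Fin L) :
    channelCoeff L p q k l =
      (L : ℂ)⁻¹ * ((if q = p ∧ k = l then 1 else 0) + if k = p ∧ l = q then 1 else 0) -
        ((L : ℂ)⁻¹) ^ 2 * if q - p + (k - l) = 0 then 1 else 0 := by
  classical
  have hL0 : (L : ℂ) ≠ 0 := cast_ne_zero_of_neZero
  rw [channelCoeff_eq_sum hL]
  have h1 : ∀ a d : ModeChar, (∑ b : ModeChar, ∑ c : ModeChar,
      if (b = a ∧ c = d) ∨ (b = d ∧ c = a) then a (-p) * b q * c k * d (-l) else 0) =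
      a (q - p) * d (k - l) + a (k - p) * d (q - l) -
        if a = d then a (q - p + (k - l)) else 0 := by
    intro a d
    -- Inclusion–exclusion: the two pairings coincide exactly when `a = d`, so that case is
    -- subtracted once.
    have h2 : ∀ b c : ModeChar,
        (if (b = a ∧ c = d) ∨ (b = d ∧ c = a) then a (-p) * b q * c k * d (-l) else 0) =
        (if b = a then (if c = d then a (-p) * b q * c k * d (-l) else 0) else 0) +
        (if b = d then (if c = a then a (-p) * b q * c k * d (-l) else 0) else 0) -
        (if a = d then (if b = a then (if c = a then a (-p) * b q * c k * d (-l) else 0) else 0)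
          else 0) := by
      intro b c
      generalize a (-p) * b q * c k * d (-l) = X
      split_ifs <;> first | ring1 | grind
    simp only [h2, Finset.sum_add_distrib, Finset.sum_sub_distrib, Finset.sum_ite_eq',
      Finset.mem_univ, if_true, Finset.sum_ite_irrel, Finset.sum_const_zero]
    simp only [sub_eq_add_neg, AddChar.map_add_eq_mul]
    split_ifs with h
    · subst h; ring
    · ring
  simp only [h1, Finset.sum_add_distrib, Finset.sum_sub_distrib, ← Finset.mul_sum,
    ← Finset.sum_mul, sum_addChar_apply, Finset.sum_ite_eq, Finset.mem_univ, if_true]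
  simp only [sub_eq_zero, ite_and, eq_comm (a := q) (b := l)]
  split_ifs <;> field_simp <;> ring

end Fourier
-- Cancellation between monomials of equal shift.
section MainTheorem
variable {L : ℕ} [NeZero L]

theorem lastMode_add_one : lastMode L + 1 = 0 := by
  obtain ⟨m, hm⟩ := Nat.exists_eq_succ_of_ne_zero (NeZero.ne L)
  subst hm
  exact Fin.last_add_one m

theorem measurementChannel_sub (hL : Odd L) {i j r s : Fin L} (hji : j ≠ i) (hsr : s ≠ r)
    (h : j - i = s - r) :
    measurementChannel L (creation i * annihilation j - creation r * annihilation s) =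
      (L : ℂ)⁻¹ • (creation i * annihilation j - creation r * annihilation s) := by
  have h1 : ∀ k l, channelCoeff L i j k l - channelCoeff L r s k l =
      (L : ℂ)⁻¹ * ((if k = i then (if l = j then 1 else 0) else 0) -
        if k = r then (if l = s then 1 else 0) else 0) := by
    intro k l
    -- Equal shifts make the `L⁻²` corrections identical, so they cancel in the difference; the `q =
    -- p` terms vanish because both shifts are nonzero.
    rw [channelCoeff_eq hL, channelCoeff_eq hL, h]
    simp only [hji, hsr, false_and, if_false, ite_and]
    ring
  rw [map_sub, measurementChannel_creation_mul_annihilation,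
    measurementChannel_creation_mul_annihilation]
  simp only [← Finset.sum_sub_distrib, ← sub_smul, h1, mul_smul, ← Finset.smul_sum]
  simp only [sub_smul, Finset.sum_sub_distrib, ite_smul, one_smul, zero_smul]
  simp [Finset.sum_ite_irrel]

end MainTheorem
end FermionShadow

theorem mainTheorem4 (L : ℕ) [NeZero L] (hL : Odd L) (i j : Fin L)
    (hi : i ≠ FermionShadow.lastMode L) (hij : j ≠ i) :
    Module.End.HasEigenvector (FermionShadow.measurementChannel L) (1 / (L : ℂ))
        (FermionShadow.creation i * FermionShadow.annihilation j -
          FermionShadow.creation (FermionShadow.lastMode L) *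
            FermionShadow.annihilation (j - i - 1)) ∧
      FermionShadow.pseudoInverse (FermionShadow.measurementChannel L)
          (FermionShadow.creation i * FermionShadow.annihilation j -
            FermionShadow.creation (FermionShadow.lastMode L) *
              FermionShadow.annihilation (j - i - 1)) =
        (L : ℂ) •
          (FermionShadow.creation i * FermionShadow.annihilation j -
            FermionShadow.creation (FermionShadow.lastMode L) *
              FermionShadow.annihilation (j - i - 1)) := by
  have hne : i ≠ j := Ne.symm hij
  have hlast : FermionShadow.lastMode L = -1 :=
    eq_neg_of_add_eq_zero_left FermionShadow.lastMode_add_one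
  -- With `L - 1` read as `-1`, equality would say `j - i = 0`.
  have hsr : j - i - 1 ≠ FermionShadow.lastMode L := by
    rw [hlast, ne_eq, sub_eq_neg_self, sub_eq_zero]
    exact hij
  have hT := FermionShadow.measurementChannel_sub hL hij hsr (by rw [hlast]; abel)
  refine ⟨⟨Module.End.mem_eigenspace_iff.2 (by rw [hT, one_div]),
    FermionShadow.creation_mul_annihilation_ne_zero_sub hne hi⟩, ?_⟩
  rw [FermionShadow.pseudoInverse_apply_of_apply_eq_smul
    (FermionShadow.hsInner_measurementChannel L)
    (inv_ne_zero FermionShadow.cast_ne_zero_of_neZero) hT, inv_inv]
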